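/- For $d\in\mathbb N$ let $X\subset\{0,\dots,d-1\}^{\mathbb Z}$ be a nonempty subshift (a nonempty closed set that is invariant under the left shift $f$ and its inverse). Let $\mathcal L(X,n)$ be the set of words of length $n$ that occur in points of $X$, and for a word $\tau$ of length $n$ let $[\tau]=\{x\in X: x_0\cdots x_{n-1}=\tau\}$. For $\varphi\in C(X,\mathbb R)$ and $n\ge 1$ put $$Z_n(\varphi)=\sum_{\tau\in\mathcal L(X,n)}\exp\Big(\sup_{x\in[\tau]}\sum_{k=0}^{n-1}\varphi(f^k(x))\Big),\qquad P_{\rm top}(X,\varphi)=\lim_{n\to\infty}\frac1n\log Z_n(\varphi).$$ An oracle for (the language of) $X$ is a function $\psi$ such that, for every $n\in\mathbb N$, $\psi(n)$ is a finite list of exactly the words in $\mathcal L(X,2n+1)$. Given such a $\psi$, an oracle for $\varphi\in C(X,\mathbb R)$ is a function $\chi$ such that, for every $n\in\mathbb N$, $\chi(n)=(k,q)$ represents a rational-valued locally constant potential $g$ with $\|g-\varphi\|_\infty<2^{-n}$; here $k\in\mathbb N$, $q$ is a list of rational numbers with one entry for each entry of the list $\psi(k)$, and $g(x)$ is the entry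 of $q$ at the position of the word $x_{-k}\cdots x_k$ in $\psi(k)$. (i) The pressure $P_{\rm top}(X,\cdot)$ is upper semi-computable on $C(X,\mathbb R)$ whenever $X$ is given by an oracle: there is one oracle Turing machine $M$ such that for every $d$, every nonempty subshift $X\subset\{0,\dots,d-1\}^{\mathbb Z}$, every oracle $\psi$ for $X$, every $\varphi\in C(X,\mathbb R)$ and every oracle $\chi$ for $\varphi$, the machine $M$ with access to $\psi$ and $\chi$ halts on every input $n\in\mathbb N$ and outputs a rational number $u_n$, such that $(u_n)_{n\in\mathbb N}$ is nonincreasing and converges to $P_{\rm top}(X,\varphi)$. (ii) For every nonempty subshift $X\subset\{0,\dots,d-1\}^{\mathbb Z}$ and every $\varphi\in C(X,\mathbb R)$, the limit defining $P_{\rm top}(X,\varphi)$ exists in $\mathbb R$, and $P_{\rm top}(X,\varphi)=\inf\{\frac1n\log Z_n(\varphi): n\ge1\}$. -/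

import Mathlib

open Filter Topology
open SymbolicDynamics.FullShift (Subshift)

namespace SubshiftPressure

/-! ### Oracle machines

An oracle machine is a program for a partial recursive function which may in addition query
finitely many oracles. Programs are finite objects that do not depend on the oracles; this is what
makes it possible to speak of one machine that works for all oracles. -/

/-- Programs of oracle machines with oracles indexed by `ι`: the constructors are those of
`Nat.RecursiveIn`, as syntax. -/
inductive OracleCode (ι : Type) : Type
  | zero : OracleCode ι
  | succ : OracleCode ι
  | left : OracleCode ι
  | right : OracleCode ι
  | oracle (i : ι) : OracleCode ι
  | pair (cf ch : OracleCode ι) : OracleCode ι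
  | comp (cf ch : OracleCode ι) : OracleCode ι
  | prec (cf ch : OracleCode ι) : OracleCode ι
  | rfind (cf : OracleCode ι) : OracleCode ι

/-- The partial function computed by a program when it is run with the oracles `O i : ℕ → ℕ`. -/
def OracleCode.eval {ι : Type} (O : ι → ℕ → ℕ) : OracleCode ι → ℕ →. ℕ
  | .zero => fun _ => Part.some 0
  | .succ => fun n => Part.some (n + 1)
  | .left => fun n => Part.some n.unpair.1
  | .right => fun n => Part.some n.unpair.2
  | .oracle i => fun n => Part.some (O i n)
  | .pair cf ch => fun n => Nat.pair <$> cf.eval O n <*> ch.eval O n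
  | .comp cf ch => fun n => ch.eval O n >>= cf.eval O
  | .prec cf ch => fun p =>
      Nat.rec (motive := fun _ => Part ℕ) (cf.eval O p.unpair.1)
        (fun y IH => do
          let i ← IH
          ch.eval O (Nat.pair p.unpair.1 (Nat.pair y i)))
        p.unpair.2
  | .rfind cf => fun a =>
      Nat.rfind fun n => (fun m => decide (m = 0)) <$> cf.eval O (Nat.pair a n)

/-- Finite codes for rational numbers: `(a, b, c)` stands for `(a - b) / (c + 1)`. -/
abbrev RatCode : Type := ℕ × ℕ × ℕ

/-- The rational number denoted by a code. -/
def RatCode.val (r : RatCode) : ℚ := ((r.1 : ℚ) - (r.2.1 : ℚ)) / ((r.2.2 : ℚ) + 1)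

/-- Run with the oracles `O`, the machine `M` halts on every input `n` and outputs (a code for) a
rational number, and these rational numbers form a nonincreasing sequence that converges to `y`. -/
def OracleCode.ApproximatesFromAbove {ι : Type} (M : OracleCode ι) (O : ι → ℕ → ℕ) (y : ℝ) :
    Prop :=
  ∃ u : ℕ → RatCode, (∀ n, Encodable.encode (u n) ∈ M.eval O n) ∧
    Antitone (fun n => (u n).val) ∧
    Tendsto (fun n => ((u n).val : ℝ)) atTop (𝓝 y)

/-! ### Subshifts over the alphabet `{0, …, d - 1}`, words, pressure -/

variable {d : ℕ}

instance (X : Subshift (Fin d) ℤ) : CompactSpace X.carrier :=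
  isCompact_iff_compactSpace.1 X.isClosed.isCompact

/-- The substring `x i, x (i + 1), …, x (i + n - 1)` of length `n` of the sequence `x`. -/
def substring (x : ℤ → Fin d) (i : ℤ) (n : ℕ) : Fin n → Fin d := fun j => x (i + (j : ℤ))

/-- The set of admissible words of length `n`: the substrings of length `n` of points of `X`. -/
def language (X : Subshift (Fin d) ℤ) (n : ℕ) : Set (Fin n → Fin d) :=
  {τ | ∃ x ∈ X.carrier, ∃ i : ℤ, substring x i n = τ}

/-- The cylinder generated by the word `τ` starting at `0`. -/
def cylinder (X : Subshift (Fin d) ℤ) {n : ℕ} (τ : Fin n → Fin d) : Set X.carrier :=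
  {x | substring x.1 0 n = τ}

/-- The left shift map of the subshift `X`. -/
def shiftMap (X : Subshift (Fin d) ℤ) : X.carrier → X.carrier :=
  (X.mapsTo 1).restrict _ _ _

/-- The `n`-th partition function
`Z_n(φ) = ∑_{τ ∈ L(X, n)} exp (sup_{x ∈ [τ]} S_n φ(x))`. -/
noncomputable def partitionFunction (X : Subshift (Fin d) ℤ) (φ : C(X.carrier, ℝ)) (n : ℕ) : ℝ :=
  ∑ τ ∈ (Set.toFinite (language X n)).toFinset,
    Real.exp (sSup (birkhoffSum (shiftMap X) φ n '' cylinder X τ))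

/-- The topological pressure `P_top(X, φ) = lim (1/n) log Z_n(φ)`. -/
noncomputable def pressure (X : Subshift (Fin d) ℤ) (φ : C(X.carrier, ℝ)) : ℝ :=
  limUnder atTop fun n : ℕ => 1 / (n : ℝ) * Real.log (partitionFunction X φ n)

/-! ### Oracles for subshifts and for potentials -/

/-- A word over `{0, …, d - 1}` as a list of natural numbers. -/
def wordList {n : ℕ} (τ : Fin n → Fin d) : List ℕ := List.ofFn fun j => (τ j : ℕ)

/-- `ψ` is an oracle for (the language of) `X`: on input `n`, it lists (in some order) all
admissible words of `X` of length `2n + 1`, and only those. -/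
def IsLanguageOracle (X : Subshift (Fin d) ℤ) (ψ : ℕ → List (List ℕ)) : Prop :=
  ∀ n, ∀ w : List ℕ, w ∈ ψ n ↔ ∃ τ ∈ language X (2 * n + 1), wordList τ = w

/-- The pair `(k, q)` represents the rational-valued locally constant potential `g`, relative to
the listing `ψ k` of the admissible words of length `2k + 1`: the list `q` has one entry for each
entry of `ψ k`, and `g x` is the entry that belongs to the word `x[-k, k]`. -/
def Represents (X : Subshift (Fin d) ℤ) (ψ : ℕ → List (List ℕ)) (k : ℕ) (q : List RatCode)
    (g : C(X.carrier, ℝ)) : Prop :=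
  q.length = (ψ k).length ∧
    ∀ x : X.carrier, ∀ p ∈ (ψ k).zip q,
      p.1 = wordList (substring x.1 (-(k : ℤ)) (2 * k + 1)) → g x = (p.2.val : ℝ)

/-- `χ` is an oracle for the potential `φ`: on input `n`, it gives a (representation of a)
rational-valued locally constant potential at supremum distance less than `2⁻ⁿ` from `φ`. -/
def IsPotentialOracle (X : Subshift (Fin d) ℤ) (ψ : ℕ → List (List ℕ)) (φ : C(X.carrier, ℝ))
    (χ : ℕ → ℕ × List RatCode) : Prop :=
  ∀ n, ∃ g : C(X.carrier, ℝ), Represents X ψ (χ n).1 (χ n).2 g ∧ ‖g - φ‖ < (2 : ℝ)⁻¹ ^ n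

/-- The two oracles `ψ` (number `0`) and `χ` (number `1`) as functions on natural numbers, by the
standard encoding of lists and pairs. -/
def oracles (ψ : ℕ → List (List ℕ)) (χ : ℕ → ℕ × List RatCode) : Fin 2 → ℕ → ℕ :=
  ![fun n => Encodable.encode (ψ n), fun n => Encodable.encode (χ n)]

/-- The machine `M` witnesses that `F : C(X, ℝ) → ℝ` is upper semi-computable, where `X` is given
by the oracle `ψ`: for every potential `φ` and every oracle `χ` for `φ`, the outputs of `M` with
access to `ψ` and `χ` are a nonincreasing sequence of rational numbers with limit `F φ`. -/
def UpperSemicomputes (M : OracleCode (Fin 2)) (X : Subshift (Fin d) ℤ) (ψ : ℕ → List (List ℕ))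
    (F : C(X.carrier, ℝ) → ℝ) : Prop :=
  ∀ (φ : C(X.carrier, ℝ)) (χ : ℕ → ℕ × List RatCode), IsPotentialOracle X ψ φ χ →
    M.ApproximatesFromAbove (oracles ψ χ) (F φ)

end SubshiftPressure

/-!
Cutting words shows that `Z_n(φ)` is submultiplicative, so by Fekete's lemma `(1/N) log Z_N(φ)`
converges to its infimum, and every `(1/N) log Z_N(φ)` is an upper bound for the pressure.

The oracles yield rational upper bounds for these numbers. To evaluate, up to the error `2⁻ⁿ`,
the potential at all `N` points of an orbit segment, one needs words of length `N + 2k`, where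
`k` is the radius of the windows on which the locally constant approximation depends; summing
over these longer words instead of the words of length `N` costs a bounded factor. To stay within
the natural numbers, the potential is shifted by an integer `C`, multiplied by `n + 2` and
rounded up, exponentials become powers of `(n + 2) / (n + 1)`, and the logarithm to this base is
found by an unbounded search. For `C ≥ ‖φ‖ + 1` the resulting bounds tend to the pressure as
first `N = 2m + 1` and then `n` tends to infinity, so their infimum over all `(n, C, m)` is the
pressure. The machine outputs the running minimum of their enumeration.
-/

namespace SubshiftPressure

section Pressure

variable {d : ℕ} {X : Subshift (Fin d) ℤ}

theorem shiftMap_iterate_apply (n : ℕ) (x : X.carrier) (j : ℤ) :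
    ((shiftMap X)^[n] x).1 j = x.1 (n + j) := by
  induction n generalizing x with
  | zero => simp
  | succ n ih =>
    rw [Function.iterate_succ_apply, ih]
    change x.1 (1 + (n + j)) = _
    exact congrArg x.1 (by push_cast; ring)

theorem substring_shiftMap_iterate (m : ℕ) (x : X.carrier) (j : ℤ) (n : ℕ) :
    substring ((shiftMap X)^[m] x).1 j n = substring x.1 (m + j) n := by
  ext l
  simp [substring, shiftMap_iterate_apply, add_assoc]

theorem substring_mem_language (x : X.carrier) (i : ℤ) (n : ℕ) :
    substring x.1 i n ∈ language X n := ⟨x.1, x.2, i, rfl⟩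

theorem exists_substring_zero_eq {n : ℕ} {τ : Fin n → Fin d} (hτ : τ ∈ language X n) :
    ∃ x : X.carrier, substring x.1 0 n = τ := by
  obtain ⟨x, hx, i, rfl⟩ := hτ
  refine ⟨⟨_, X.mapsTo i hx⟩, funext fun l => ?_⟩
  change x (i + (0 + l)) = x (i + l)
  rw [zero_add]

theorem abs_birkhoffSum_le (φ : C(X.carrier, ℝ)) (n : ℕ) (x : X.carrier) :
    |birkhoffSum (shiftMap X) φ n x| ≤ n * ‖φ‖ := by
  refine (Finset.abs_sum_le_sum_abs _ _).trans ?_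
  refine (Finset.sum_le_card_nsmul _ _ ‖φ‖ fun i _ => φ.norm_coe_le_norm _).trans ?_
  simp

theorem birkhoffSum_shiftMap_iterate_le (φ : C(X.carrier, ℝ)) (a n b : ℕ) (x : X.carrier) :
    birkhoffSum (shiftMap X) φ n ((shiftMap X)^[a] x) ≤
      birkhoffSum (shiftMap X) φ (a + n + b) x + (a + b) * ‖φ‖ := by
  rw [birkhoffSum_add, birkhoffSum_add]
  linarith [neg_abs_le (birkhoffSum (shiftMap X) φ a x), abs_birkhoffSum_le φ a x,
    neg_abs_le (birkhoffSum (shiftMap X) φ b ((shiftMap X)^[a + n] x)),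
    abs_birkhoffSum_le φ b ((shiftMap X)^[a + n] x)]

theorem birkhoffSum_le_sSup_cylinder (φ : C(X.carrier, ℝ)) (n : ℕ) (x : X.carrier) :
    birkhoffSum (shiftMap X) φ n x ≤
      sSup (birkhoffSum (shiftMap X) φ n '' cylinder X (substring x.1 0 n)) := by
  refine le_csSup ⟨n * ‖φ‖, ?_⟩ ⟨x, rfl, rfl⟩
  rintro _ ⟨y, -, rfl⟩
  exact (abs_le.1 (abs_birkhoffSum_le φ n y)).2

variable (φ : C(X.carrier, ℝ))

theorem partitionFunction_le_sum_exp {a n l : ℕ} (hl : a + n ≤ l) (F : (Fin l → Fin d) → ℝ)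
    (hF : ∀ x : X.carrier, birkhoffSum (shiftMap X) φ n x ≤ F (substring x.1 (-(a : ℤ)) l)) :
    partitionFunction X φ n ≤ ∑ w ∈ (Set.toFinite (language X l)).toFinset, Real.exp (F w) := by
  classical
  let middle (w : Fin l → Fin d) : Fin n → Fin d := fun i => w ⟨a + i, by omega⟩
  have middle_substring (x : ℤ → Fin d) (i : ℤ) :
      middle (substring x i l) = substring x (i + a) n := by
    ext j
    simp [middle, substring, add_assoc]
  have maps_to : ∀ w ∈ (Set.toFinite (language X l)).toFinset,
      middle w ∈ (Set.toFinite (language X n)).toFinset := by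
    simp only [Set.Finite.mem_toFinset]
    rintro _ ⟨x, hx, i, rfl⟩
    exact ⟨x, hx, i + a, (middle_substring x i).symm⟩
  rw [← Finset.sum_fiberwise_of_maps_to maps_to]
  refine Finset.sum_le_sum fun τ hτ => ?_
  obtain ⟨x₀, hx₀⟩ := exists_substring_zero_eq ((Set.Finite.mem_toFinset _).1 hτ)
  have exp_le (x : X.carrier) (hx : x ∈ cylinder X τ) :
      Real.exp (birkhoffSum (shiftMap X) φ n x) ≤
        ∑ w ∈ (Set.toFinite (language X l)).toFinset with middle w = τ, Real.exp (F w) := by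
    refine (Real.exp_le_exp.2 (hF x)).trans
      (Finset.single_le_sum (f := fun w => Real.exp (F w)) (fun _ _ => (Real.exp_pos _).le) ?_)
    simpa [substring_mem_language, middle_substring, cylinder] using hx
  have sum_pos := (Real.exp_pos _).trans_le (exp_le x₀ hx₀)
  rw [← Real.le_log_iff_exp_le sum_pos]
  refine csSup_le ⟨_, x₀, hx₀, rfl⟩ ?_
  rintro _ ⟨x, hx, rfl⟩
  exact (Real.le_log_iff_exp_le sum_pos).2 (exp_le x hx)

theorem sum_exp_le_partitionFunction {n : ℕ} (F : (Fin n → Fin d) → ℝ)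
    (hF : ∀ x : X.carrier, F (substring x.1 0 n) ≤ birkhoffSum (shiftMap X) φ n x) :
    ∑ τ ∈ (Set.toFinite (language X n)).toFinset, Real.exp (F τ) ≤ partitionFunction X φ n := by
  refine Finset.sum_le_sum fun τ hτ => Real.exp_le_exp.2 ?_
  obtain ⟨x, rfl⟩ := exists_substring_zero_eq ((Set.Finite.mem_toFinset _).1 hτ)
  exact (hF x).trans (birkhoffSum_le_sSup_cylinder φ n x)

theorem exp_neg_le_partitionFunction (hX : X.carrier.Nonempty) (n : ℕ) :
    Real.exp (-(n * ‖φ‖)) ≤ partitionFunction X φ n := by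
  refine le_trans ?_ (sum_exp_le_partitionFunction φ (fun _ => -(n * ‖φ‖)) fun x =>
    (abs_le.1 (abs_birkhoffSum_le φ n x)).1)
  exact Finset.single_le_sum (f := fun _ : Fin n → Fin d => Real.exp (-(n * ‖φ‖)))
    (fun _ _ => (Real.exp_pos _).le)
    ((Set.Finite.mem_toFinset _).2 (substring_mem_language ⟨_, hX.some_mem⟩ 0 n))

theorem partitionFunction_pos (hX : X.carrier.Nonempty) (n : ℕ) :
    0 < partitionFunction X φ n :=
  (Real.exp_pos _).trans_le (exp_neg_le_partitionFunction φ hX n)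

theorem neg_le_log_partitionFunction (hX : X.carrier.Nonempty) (n : ℕ) :
    -(n * ‖φ‖) ≤ Real.log (partitionFunction X φ n) :=
  (Real.le_log_iff_exp_le (partitionFunction_pos φ hX n)).2 (exp_neg_le_partitionFunction φ hX n)

theorem partitionFunction_add_le (m n : ℕ) :
    partitionFunction X φ (m + n) ≤ partitionFunction X φ m * partitionFunction X φ n := by
  classical
  let split := (Fin.appendEquiv (α := Fin d) m n).symm
  have split_substring (x : X.carrier) : split (substring x.1 0 (m + n)) =
      (substring x.1 0 m, substring ((shiftMap X)^[m] x).1 0 n) := by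
    rw [substring_shiftMap_iterate]
    refine Prod.ext ?_ ?_ <;> ext i <;> simp [split, Fin.appendEquiv, substring]
  let s (l : ℕ) (τ : Fin l → Fin d) : ℝ := sSup (birkhoffSum (shiftMap X) φ l '' cylinder X τ)
  refine (partitionFunction_le_sum_exp (a := 0) φ (zero_add _).le
    (fun τ => s m (split τ).1 + s n (split τ).2) fun x => ?_).trans ?_
  · rw [Nat.cast_zero, neg_zero, birkhoffSum_add, split_substring]
    exact add_le_add (birkhoffSum_le_sSup_cylinder φ m x) (birkhoffSum_le_sSup_cylinder φ n _)
  · unfold partitionFunction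
    simp only [Finset.sum_mul_sum, ← Finset.sum_product', ← Real.exp_add]
    rw [← Finset.sum_image (f := fun p => Real.exp (s m p.1 + s n p.2)) split.injective.injOn]
    refine Finset.sum_le_sum_of_subset_of_nonneg ?_ fun _ _ _ => (Real.exp_pos _).le
    refine Finset.image_subset_iff.2 fun τ hτ => ?_
    obtain ⟨x, rfl⟩ := exists_substring_zero_eq ((Set.Finite.mem_toFinset _).1 hτ)
    simp [split_substring, substring_mem_language]

theorem log_partitionFunction_add_le (hX : X.carrier.Nonempty) (m n : ℕ) :
    Real.log (partitionFunction X φ (m + n)) ≤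
      Real.log (partitionFunction X φ m) + Real.log (partitionFunction X φ n) := by
  rw [← Real.log_mul (partitionFunction_pos φ hX m).ne' (partitionFunction_pos φ hX n).ne']
  exact Real.log_le_log (partitionFunction_pos φ hX _) (partitionFunction_add_le φ m n)

theorem bddBelow_log_partitionFunction_div (hX : X.carrier.Nonempty) :
    BddBelow (Set.range fun n : ℕ => Real.log (partitionFunction X φ n) / n) := by
  refine ⟨-‖φ‖, ?_⟩
  rintro _ ⟨n, rfl⟩
  rcases n.eq_zero_or_pos with rfl | hn
  · simp
  · rw [le_div_iff₀' (by exact_mod_cast hn), mul_neg]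
    exact neg_le_log_partitionFunction φ hX n

theorem tendsto_log_partitionFunction (hX : X.carrier.Nonempty) :
    Tendsto (fun n : ℕ => 1 / (n : ℝ) * Real.log (partitionFunction X φ n)) atTop
      (𝓝 (pressure X φ)) := by
  have subadditive : Subadditive fun n => Real.log (partitionFunction X φ n) :=
    log_partitionFunction_add_le φ hX
  refine tendsto_nhds_limUnder ⟨subadditive.lim, ?_⟩
  simpa only [one_div_mul_eq_div] using
    subadditive.tendsto_lim (bddBelow_log_partitionFunction_div φ hX)

theorem pressure_le (hX : X.carrier.Nonempty) {n : ℕ} (hn : 1 ≤ n) :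
    pressure X φ ≤ 1 / (n : ℝ) * Real.log (partitionFunction X φ n) := by
  have subadditive : Subadditive fun n => Real.log (partitionFunction X φ n) :=
    log_partitionFunction_add_le φ hX
  have bddBelow := bddBelow_log_partitionFunction_div φ hX
  have tendsto_pressure := tendsto_log_partitionFunction φ hX
  simp only [one_div_mul_eq_div] at tendsto_pressure ⊢
  rw [tendsto_nhds_unique tendsto_pressure (subadditive.tendsto_lim bddBelow)]
  exact subadditive.lim_le_div bddBelow (by omega)

theorem isGLB_pressure (hX : X.carrier.Nonempty) :
    IsGLB {r : ℝ | ∃ n : ℕ, 1 ≤ n ∧ r = 1 / (n : ℝ) * Real.log (partitionFunction X φ n)}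
      (pressure X φ) := by
  refine ⟨?_, fun b hb => ?_⟩
  · rintro _ ⟨n, hn, rfl⟩
    exact pressure_le φ hX hn
  · refine ge_of_tendsto (tendsto_log_partitionFunction φ hX) ?_
    filter_upwards [eventually_ge_atTop 1] with n hn
    exact hb ⟨n, hn, rfl⟩

end Pressure

section OracleComputable

open Encodable

variable {ι Ω α β γ : Type} [Primcodable α] [Primcodable β] [Primcodable γ]

/-- The functions `F ω : α → β`, for all parameters `ω`, are computed by one and the same oracle
machine, which for the parameter `ω` is given the oracles `O ω`. -/
def OracleComputable (O : Ω → ι → ℕ → ℕ) (F : Ω → α → β) : Prop :=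
  ∃ c : OracleCode ι, ∀ ω a, encode (F ω a) ∈ c.eval (O ω) (encode a)

theorem exists_oracleCode_eval_eq {f : ℕ →. ℕ} (hf : Nat.Partrec f) :
    ∃ c : OracleCode ι, ∀ O, c.eval O = f := by
  induction hf with
  | zero => exact ⟨.zero, fun _ => rfl⟩
  | succ => exact ⟨.succ, fun _ => rfl⟩
  | left => exact ⟨.left, fun _ => rfl⟩
  | right => exact ⟨.right, fun _ => rfl⟩
  | pair _ _ hf hg =>
    obtain ⟨c, hc⟩ := hf
    obtain ⟨e, he⟩ := hg
    exact ⟨.pair c e, fun O => by simp only [OracleCode.eval, hc, he]; rfl⟩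
  | comp _ _ hf hg =>
    obtain ⟨c, hc⟩ := hf
    obtain ⟨e, he⟩ := hg
    exact ⟨.comp c e, fun O => by simp only [OracleCode.eval, hc, he]; rfl⟩
  | prec _ _ hf hg =>
    obtain ⟨c, hc⟩ := hf
    obtain ⟨e, he⟩ := hg
    exact ⟨.prec c e, fun O => by simp only [OracleCode.eval, hc, he]; rfl⟩
  | rfind _ hf =>
    obtain ⟨c, hc⟩ := hf
    exact ⟨.rfind c, fun O => by simp only [OracleCode.eval, hc]; rfl⟩

variable {O : Ω → ι → ℕ → ℕ}

theorem OracleComputable.of_computable {f : α → β} (hf : Computable f) :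
    OracleComputable O fun _ => f := by
  obtain ⟨c, hc⟩ := exists_oracleCode_eval_eq (ι := ι) hf
  exact ⟨c, fun ω a => by simp [hc]⟩

theorem OracleComputable.comp {F : Ω → β → γ} {G : Ω → α → β} (hF : OracleComputable O F)
    (hG : OracleComputable O G) : OracleComputable O fun ω a => F ω (G ω a) := by
  obtain ⟨c, hc⟩ := hF
  obtain ⟨e, he⟩ := hG
  exact ⟨.comp c e, fun ω a => Part.mem_bind (he ω a) (hc ω _)⟩

theorem OracleComputable.pair {F : Ω → α → β} {G : Ω → α → γ} (hF : OracleComputable O F)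
    (hG : OracleComputable O G) : OracleComputable O fun ω a => (F ω a, G ω a) := by
  obtain ⟨c, hc⟩ := hF
  obtain ⟨e, he⟩ := hG
  refine ⟨.pair c e, fun ω a => ?_⟩
  simp [OracleCode.eval, Part.eq_some_iff.2 (hc ω a), Part.eq_some_iff.2 (he ω a), Seq.seq]

theorem OracleComputable.query {i : ι} {G : Ω → ℕ → β} (hG : ∀ ω n, O ω i n = encode (G ω n)) :
    OracleComputable O G :=
  ⟨.oracle i, fun ω n => by simp [OracleCode.eval, hG]⟩

theorem OracleComputable.nat_rec {F : Ω → α → β} {G : Ω → α × ℕ × β → β}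
    (hF : OracleComputable O F) (hG : OracleComputable O G) :
    OracleComputable O fun ω (p : α × ℕ) =>
      Nat.rec (motive := fun _ => β) (F ω p.1) (fun y b => G ω (p.1, y, b)) p.2 := by
  obtain ⟨c, hc⟩ := hF
  obtain ⟨e, he⟩ := hG
  refine ⟨.prec c e, fun ω ⟨a, n⟩ => ?_⟩
  simp only [OracleCode.eval, encode_prod_val, Nat.unpair_pair, encode_nat]
  induction n with
  | zero => exact hc ω a
  | succ n ih => exact Part.mem_bind ih (he ω (a, n, _))

end OracleComputable

section RunningMinimum

/-- A code for the smaller of two coded rational numbers. -/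
def RatCode.min (r s : RatCode) : RatCode := if r.val ≤ s.val then r else s

theorem RatCode.val_min (r s : RatCode) : (RatCode.min r s).val = r.val ⊓ s.val := by
  unfold RatCode.min
  split_ifs with h
  · exact (min_eq_left h).symm
  · exact (min_eq_right (not_le.1 h).le).symm

theorem RatCode.val_le_val_iff (r s : RatCode) : r.val ≤ s.val ↔
    r.1 * (s.2.2 + 1) + s.2.1 * (r.2.2 + 1) ≤ s.1 * (r.2.2 + 1) + r.2.1 * (s.2.2 + 1) := by
  rw [RatCode.val, RatCode.val, div_le_div_iff₀ (by positivity) (by positivity), sub_mul, sub_mul,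
    sub_le_sub_iff]
  exact_mod_cast Iff.rfl

theorem RatCode.primrec_min : Primrec fun p : RatCode × RatCode => RatCode.min p.1 p.2 := by
  have num {f : RatCode × RatCode → RatCode} (hf : Primrec f) : Primrec fun p => (f p).1 :=
    Primrec.fst.comp hf
  have sub {f : RatCode × RatCode → RatCode} (hf : Primrec f) : Primrec fun p => (f p).2.1 :=
    Primrec.fst.comp (Primrec.snd.comp hf)
  have den {f : RatCode × RatCode → RatCode} (hf : Primrec f) : Primrec fun p => (f p).2.2 + 1 :=
    Primrec.succ.comp (Primrec.snd.comp (Primrec.snd.comp hf))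
  have cross {f g : RatCode × RatCode → RatCode} (hf : Primrec f) (hg : Primrec g) :
      Primrec fun p => (f p).1 * ((g p).2.2 + 1) + (g p).2.1 * ((f p).2.2 + 1) :=
    Primrec.nat_add.comp (Primrec.nat_mul.comp (num hf) (den hg))
      (Primrec.nat_mul.comp (sub hg) (den hf))
  have val_le : PrimrecPred fun p : RatCode × RatCode => p.1.val ≤ p.2.val :=
    (Primrec.nat_le.comp (cross .fst .snd) (cross .snd .fst)).of_eq fun p =>
      (RatCode.val_le_val_iff p.1 p.2).symm
  exact (Primrec.ite val_le .fst .snd).of_eq fun p => rfl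

/-- The minimum of the first `i + 1` terms of a sequence of coded rational numbers. -/
def runningMin (b : ℕ → RatCode) (i : ℕ) : RatCode :=
  Nat.rec (b 0) (fun j r => RatCode.min r (b (j + 1))) i

theorem val_runningMin_succ (b : ℕ → RatCode) (i : ℕ) :
    (runningMin b (i + 1)).val = (runningMin b i).val ⊓ (b (i + 1)).val :=
  RatCode.val_min _ _

theorem antitone_val_runningMin (b : ℕ → RatCode) : Antitone fun i => (runningMin b i).val :=
  antitone_nat_of_succ_le fun i => (val_runningMin_succ b i).trans_le inf_le_left

theorem val_runningMin_le (b : ℕ → RatCode) (i : ℕ) : (runningMin b i).val ≤ (b i).val := by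
  cases i with
  | zero => exact le_rfl
  | succ i => exact (val_runningMin_succ b i).trans_le inf_le_right

theorem le_val_runningMin {b : ℕ → RatCode} {y : ℝ} (h : ∀ j, y ≤ (b j).val) (i : ℕ) :
    y ≤ (runningMin b i).val := by
  induction i with
  | zero => exact h 0
  | succ i ih =>
    rw [val_runningMin_succ, Rat.cast_min]
    exact le_min ih (h _)

theorem tendsto_val_runningMin {b : ℕ → RatCode} {y : ℝ}
    (hy : IsGLB (Set.range fun j => ((b j).val : ℝ)) y) :
    Tendsto (fun i => ((runningMin b i).val : ℝ)) atTop (𝓝 y) := by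
  have antitone : Antitone fun i => ((runningMin b i).val : ℝ) := fun _ _ hij =>
    Rat.cast_le.2 (antitone_val_runningMin b hij)
  refine tendsto_atTop_isGLB antitone ⟨?_, fun z hz => hy.2 ?_⟩
  · rintro _ ⟨i, rfl⟩
    exact le_val_runningMin (fun j => hy.1 ⟨j, rfl⟩) i
  · rintro _ ⟨j, rfl⟩
    exact (hz ⟨j, rfl⟩).trans (Rat.cast_le.2 (val_runningMin_le b j))

theorem OracleComputable.runningMin {ι Ω : Type} {O : Ω → ι → ℕ → ℕ} {b : Ω → ℕ → RatCode}
    (hb : OracleComputable O b) : OracleComputable O fun ω => runningMin (b ω) := by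
  have first : OracleComputable O fun ω (_ : Unit) => b ω 0 :=
    hb.comp (.of_computable (Computable.const 0))
  have arguments : OracleComputable O fun ω (p : Unit × ℕ × RatCode) =>
      (p.2.2, b ω (p.2.1 + 1)) :=
    .pair (.of_computable (Computable.snd.comp Computable.snd))
      (hb.comp (.of_computable (Computable.succ.comp (Computable.fst.comp Computable.snd))))
  have next := (OracleComputable.of_computable RatCode.primrec_min.to_comp).comp arguments
  exact (first.nat_rec next).comp (.of_computable ((Computable.const ()).pair Computable.id))

theorem OracleComputable.exists_approximatesFromAbove {ι Ω α : Type} [Denumerable α]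
    {O : Ω → ι → ℕ → ℕ} {b : Ω → α → RatCode} (hb : OracleComputable O b) :
    ∃ M : OracleCode ι, ∀ (ω : Ω) (y : ℝ), IsGLB (Set.range fun a => ((b ω a).val : ℝ)) y →
      M.ApproximatesFromAbove (O ω) y := by
  have hb' : OracleComputable O fun ω j => b ω (Denumerable.ofNat α j) :=
    hb.comp (.of_computable (Computable.ofNat α))
  obtain ⟨M, hM⟩ := hb'.runningMin
  refine ⟨M, fun ω y hy => ⟨_, hM ω, antitone_val_runningMin _, tendsto_val_runningMin ?_⟩⟩
  rwa [← (Denumerable.eqv α).symm.surjective.range_comp] at hy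

end RunningMinimum

section CeilLogSum

/-- The base `(n + 2) / (n + 1)` of the powers that replace exponentials; its logarithm lies
between `1 / (n + 2)` and `1 / (n + 1)`. -/
noncomputable def expBase (n : ℕ) : ℝ := (n + 2) / (n + 1)

theorem one_lt_expBase (n : ℕ) : 1 < expBase n := by
  rw [expBase, one_lt_div (by positivity)]
  linarith

theorem inv_le_log_expBase (n : ℕ) : ((n : ℝ) + 2)⁻¹ ≤ Real.log (expBase n) := by
  refine le_trans (le_of_eq ?_) (Real.one_sub_inv_le_log_of_pos (by unfold expBase; positivity))
  rw [expBase]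
  field_simp
  ring

theorem log_expBase_le_inv (n : ℕ) : Real.log (expBase n) ≤ ((n : ℝ) + 1)⁻¹ := by
  refine (Real.log_le_sub_one_of_pos (by unfold expBase; positivity)).trans (le_of_eq ?_)
  rw [expBase]
  field_simp
  ring

theorem expBase_pow_eq_exp (n t : ℕ) : expBase n ^ t = Real.exp (t * Real.log (expBase n)) := by
  rw [← Real.log_pow, Real.exp_log (pow_pos (by unfold expBase; positivity) t)]

theorem exp_div_le_expBase_pow (n t : ℕ) : Real.exp (t / ((n : ℝ) + 2)) ≤ expBase n ^ t := by
  rw [expBase_pow_eq_exp, Real.exp_le_exp, div_eq_mul_inv]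
  gcongr
  exact inv_le_log_expBase n

theorem expBase_pow_le_exp_div (n t : ℕ) : expBase n ^ t ≤ Real.exp (t / ((n : ℝ) + 1)) := by
  rw [expBase_pow_eq_exp, Real.exp_le_exp, div_eq_mul_inv]
  gcongr
  exact log_expBase_le_inv n

/-- The logarithm of `∑ t ∈ ts, expBase n ^ t` to base `expBase n`, rounded up: a computable
substitute for the logarithm of a sum of exponentials. -/
noncomputable def ceilLogSum (n : ℕ) (ts : List ℕ) : ℕ :=
  ⌈Real.logb (expBase n) (ts.map (expBase n ^ ·)).sum⌉₊

theorem ceilLogSum_le_iff {n : ℕ} {ts : List ℕ} {p : ℕ} :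
    ceilLogSum n ts ≤ p ↔ (ts.map (expBase n ^ ·)).sum ≤ expBase n ^ p := by
  have base_pos : 0 < expBase n := one_pos.trans (one_lt_expBase n)
  rw [ceilLogSum, Nat.ceil_le]
  rcases ts.eq_nil_or_concat' with rfl | ⟨ts, t, rfl⟩
  · simpa using (pow_pos base_pos p).le
  · have sum_nonneg : 0 ≤ (ts.map (expBase n ^ ·)).sum := by
      refine List.sum_nonneg fun y hy => ?_
      obtain ⟨t, -, rfl⟩ := List.mem_map.1 hy
      exact (pow_pos base_pos t).le
    have sum_pos : 0 < ((ts ++ [t]).map (expBase n ^ ·)).sum := by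
      simpa using add_pos_of_nonneg_of_pos sum_nonneg (pow_pos base_pos t)
    rw [Real.logb_le_iff_le_rpow (one_lt_expBase n) sum_pos, Real.rpow_natCast]

theorem ceilLogSum_le_iff_nat {n : ℕ} {ts : List ℕ} {p : ℕ} :
    ceilLogSum n ts ≤ p ↔
      (ts.map fun t => (n + 2) ^ t * (n + 1) ^ (ts.sum - t)).sum * (n + 1) ^ p ≤
        (n + 2) ^ p * (n + 1) ^ ts.sum := by
  have clear_denominators : (((ts.map fun t => (n + 2) ^ t * (n + 1) ^ (ts.sum - t)).sum : ℕ) : ℝ) =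
      (ts.map (expBase n ^ ·)).sum * (n + 1) ^ ts.sum := by
    rw [Nat.cast_list_sum, List.map_map, ← List.sum_map_mul_right]
    refine congrArg List.sum (List.map_congr_left fun t ht => ?_)
    have ht' : t ≤ ts.sum := List.le_sum_of_mem ht
    simp only [Function.comp_apply, expBase, div_pow]
    push_cast
    rw [div_mul_eq_mul_div, eq_div_iff (by positivity), mul_assoc, ← pow_add,
      Nat.sub_add_cancel ht']
  rw [ceilLogSum_le_iff, ← Nat.cast_le (α := ℝ)]
  push_cast
  push_cast at clear_denominators
  rw [clear_denominators, expBase, div_pow, le_div_iff₀ (by positivity), mul_right_comm]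
  exact (mul_le_mul_iff_of_pos_right (by positivity)).symm

theorem sum_exp_le_exp_ceilLogSum (n : ℕ) (ts : List ℕ) :
    (ts.map fun t : ℕ => Real.exp (t / ((n : ℝ) + 2))).sum ≤
      Real.exp (ceilLogSum n ts / ((n : ℝ) + 1)) :=
  (List.sum_le_sum fun t _ => exp_div_le_expBase_pow n t).trans
    ((ceilLogSum_le_iff.1 le_rfl).trans (expBase_pow_le_exp_div n _))

theorem ceilLogSum_le_of_sum_exp_le {n : ℕ} {ts : List ℕ} {y : ℝ} (hy : 0 ≤ y)
    (h : (ts.map fun t : ℕ => Real.exp (t / ((n : ℝ) + 1))).sum ≤ Real.exp y) :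
    (ceilLogSum n ts : ℝ) ≤ (n + 2) * y + 1 := by
  have ceil_le : ceilLogSum n ts ≤ ⌈(n + 2) * y⌉₊ := by
    rw [ceilLogSum_le_iff]
    refine ((List.sum_le_sum fun t _ => expBase_pow_le_exp_div n t).trans h).trans ?_
    refine le_trans (Real.exp_le_exp.2 ?_) (exp_div_le_expBase_pow n _)
    rw [le_div_iff₀' (by positivity)]
    exact Nat.le_ceil _
  exact (Nat.cast_le.2 ceil_le).trans (Nat.ceil_lt_add_one (by positivity)).le

end CeilLogSum

section WordWeight

/-- A natural number that exceeds `(n + 2) * (y + C)`, but not by more than `5`, for every real `y`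
with `|r.val - y| ≤ 2⁻ⁿ` and `1 ≤ y + C`. -/
def scaledEntry (n C : ℕ) (r : RatCode) : ℕ := ⌈((n : ℚ) + 2) * (r.val + C)⌉₊ + 2

theorem add_two_mul_inv_two_pow_le (n : ℕ) : ((n : ℝ) + 2) * 2⁻¹ ^ n ≤ 2 := by
  rw [inv_pow, ← div_eq_mul_inv, div_le_iff₀ (by positivity)]
  have : n + 2 ≤ 2 ^ (n + 1) := Nat.lt_two_pow_self
  rw [pow_succ'] at this
  exact_mod_cast this

theorem le_scaledEntry {n : ℕ} {r : RatCode} {y : ℝ} (h : |(r.val : ℝ) - y| ≤ 2⁻¹ ^ n) (C : ℕ) :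
    ((n : ℝ) + 2) * (y + C) ≤ scaledEntry n C r := by
  have le_ceil : ((n : ℝ) + 2) * (r.val + C) ≤ ⌈((n : ℚ) + 2) * (r.val + C)⌉₊ := by
    exact_mod_cast Nat.le_ceil (((n : ℚ) + 2) * (r.val + C))
  have error : ((n : ℝ) + 2) * (y - r.val) ≤ (n + 2) * 2⁻¹ ^ n := by
    gcongr
    linarith [(abs_le.1 h).1]
  rw [scaledEntry]
  push_cast
  linarith [add_two_mul_inv_two_pow_le n]

theorem scaledEntry_le {n C : ℕ} {r : RatCode} {y : ℝ} (h : |(r.val : ℝ) - y| ≤ 2⁻¹ ^ n)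
    (hy : 1 ≤ y + C) : (scaledEntry n C r : ℝ) ≤ ((n : ℝ) + 2) * (y + C) + 5 := by
  have error_le_one : (2⁻¹ : ℝ) ^ n ≤ 1 := pow_le_one₀ (by norm_num) (by norm_num)
  have val_nonneg : (0 : ℚ) ≤ r.val + C := by
    have : (0 : ℝ) ≤ r.val + C := by linarith [(abs_le.1 h).1]
    exact_mod_cast this
  have ceil_le : (⌈((n : ℚ) + 2) * (r.val + C)⌉₊ : ℝ) ≤ (n + 2) * (r.val + C) + 1 := by
    exact_mod_cast (Nat.ceil_lt_add_one (mul_nonneg (by positivity) val_nonneg)).le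
  have error : ((n : ℝ) + 2) * (r.val - y) ≤ (n + 2) * 2⁻¹ ^ n := by
    gcongr
    exact (abs_le.1 h).2
  rw [scaledEntry]
  push_cast
  linarith [add_two_mul_inv_two_pow_le n]

/-- The entry of the list `q` at the position of the word `v` in the list `L`. -/
def entryAt (L : List (List ℕ)) (q : List RatCode) (v : List ℕ) : RatCode :=
  q.getD (L.findIdx (· = v)) default

/-- The sum, over the `N` windows of length `2 * k + 1` in `w` that start at the positions
`0, …, N - 1`, of the scaled entries of the potential represented by `c = (k, q)` relative to `L`.
It approximates `n + 2` times a Birkhoff sum of length `N`. -/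
def wordWeight (n C N : ℕ) (L : List (List ℕ)) (c : ℕ × List RatCode) (w : List ℕ) : ℕ :=
  ((List.range N).map fun i =>
    scaledEntry n C (entryAt L c.2 ((w.drop i).take (2 * c.1 + 1)))).sum

variable {d : ℕ} {X : Subshift (Fin d) ℤ} {ψ : ℕ → List (List ℕ)}

theorem wordList_injective {n : ℕ} : Function.Injective (wordList : (Fin n → Fin d) → List ℕ) :=
  fun τ τ' h => by
    ext i
    exact congrFun (List.ofFn_injective h) i

theorem take_drop_wordList_substring (x : ℤ → Fin d) (j : ℤ) {i l N : ℕ} (h : i + l ≤ N) :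
    ((wordList (substring x j N)).drop i).take l = wordList (substring x (i + j) l) := by
  refine List.ext_getElem (by simp [wordList]; omega) fun a _ _ => ?_
  simp only [wordList, substring, List.getElem_take, List.getElem_drop, List.getElem_ofFn]
  exact congrArg (fun b => (x b : ℕ)) (by push_cast; ring)

theorem IsLanguageOracle.sum_dedup {M : Type*} [AddCommMonoid M] (hψ : IsLanguageOracle X ψ)
    (m : ℕ) (f : List ℕ → M) : ((ψ m).dedup.map f).sum =
      ∑ τ ∈ (Set.toFinite (language X (2 * m + 1))).toFinset, f (wordList τ) := by
  classical
  rw [← List.sum_toFinset f (List.nodup_dedup _),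
    ← Finset.sum_image (f := f) wordList_injective.injOn]
  congr 1
  ext w
  simp [hψ m w]

theorem Represents.val_entryAt {k : ℕ} {q : List RatCode} {g : C(X.carrier, ℝ)}
    (hg : Represents X ψ k q g) (hψ : IsLanguageOracle X ψ) (y : X.carrier) :
    ((entryAt (ψ k) q (wordList (substring y.1 (-(k : ℤ)) (2 * k + 1)))).val : ℝ) = g y := by
  set v := wordList (substring y.1 (-(k : ℤ)) (2 * k + 1))
  have mem : v ∈ ψ k := (hψ k v).2 ⟨_, substring_mem_language y _ _, rfl⟩
  have lt_length : (ψ k).findIdx (· = v) < (ψ k).length :=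
    List.findIdx_lt_length_of_exists ⟨v, mem, by simp⟩
  have lt_length' : (ψ k).findIdx (· = v) < q.length := hg.1 ▸ lt_length
  rw [entryAt, List.getD_eq_getElem _ _ lt_length']
  have lt_length_zip : (ψ k).findIdx (· = v) < ((ψ k).zip q).length := by
    rw [List.length_zip]
    exact lt_min lt_length lt_length'
  refine (hg.2 y _ (List.mem_iff_getElem.2 ⟨_, lt_length_zip, List.getElem_zip⟩) ?_).symm
  simpa using List.findIdx_getElem (w := lt_length)

variable {φ : C(X.carrier, ℝ)} {χ : ℕ → ℕ × List RatCode}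

theorem IsPotentialOracle.abs_val_entryAt_sub_le (hχ : IsPotentialOracle X ψ φ χ)
    (hψ : IsLanguageOracle X ψ) (n : ℕ) (y : X.carrier) :
    |((entryAt (ψ (χ n).1) (χ n).2
      (wordList (substring y.1 (-((χ n).1 : ℤ)) (2 * (χ n).1 + 1)))).val : ℝ) - φ y| ≤ 2⁻¹ ^ n := by
  obtain ⟨g, hg, hgφ⟩ := hχ n
  rw [hg.val_entryAt hψ y]
  exact ((g - φ).norm_coe_le_norm y).trans hgφ.le

theorem wordWeight_wordList_substring {c : ℕ × List RatCode} {N l : ℕ} (hl : N + 2 * c.1 ≤ l)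
    (n C : ℕ) (L : List (List ℕ)) (x : X.carrier) :
    wordWeight n C N L c (wordList (substring x.1 (-(c.1 : ℤ)) l)) =
      ∑ i ∈ Finset.range N, scaledEntry n C (entryAt L c.2
        (wordList (substring ((shiftMap X)^[i] x).1 (-(c.1 : ℤ)) (2 * c.1 + 1)))) := by
  rw [wordWeight, ← List.sum_toFinset _ List.nodup_range, List.toFinset_range]
  refine Finset.sum_congr rfl fun i hi => ?_
  have := Finset.mem_range.1 hi
  rw [take_drop_wordList_substring _ _ (by omega), substring_shiftMap_iterate]

theorem sum_add_eq_birkhoffSum (N C : ℕ) (x : X.carrier) :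
    ∑ i ∈ Finset.range N, (φ ((shiftMap X)^[i] x) + C) =
      birkhoffSum (shiftMap X) φ N x + N * C := by
  simp [birkhoffSum, Finset.sum_add_distrib]

theorem IsPotentialOracle.le_wordWeight (hχ : IsPotentialOracle X ψ φ χ)
    (hψ : IsLanguageOracle X ψ) {n N l : ℕ} (hl : N + 2 * (χ n).1 ≤ l) (C : ℕ) (x : X.carrier) :
    ((n : ℝ) + 2) * (birkhoffSum (shiftMap X) φ N x + N * C) ≤
      wordWeight n C N (ψ (χ n).1) (χ n) (wordList (substring x.1 (-((χ n).1 : ℤ)) l)) := by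
  rw [wordWeight_wordList_substring hl, ← sum_add_eq_birkhoffSum, Finset.mul_sum, Nat.cast_sum]
  exact Finset.sum_le_sum fun i _ => le_scaledEntry (hχ.abs_val_entryAt_sub_le hψ n _) C

theorem IsPotentialOracle.wordWeight_le (hχ : IsPotentialOracle X ψ φ χ)
    (hψ : IsLanguageOracle X ψ) {n C N l : ℕ} (hl : N + 2 * (χ n).1 ≤ l) (hC : ‖φ‖ + 1 ≤ C)
    (x : X.carrier) :
    (wordWeight n C N (ψ (χ n).1) (χ n) (wordList (substring x.1 (-((χ n).1 : ℤ)) l)) : ℝ) ≤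
      ((n : ℝ) + 2) * (birkhoffSum (shiftMap X) φ N x + N * C) + N * 5 := by
  have one_le (y : X.carrier) : 1 ≤ φ y + C := by
    linarith [neg_abs_le (φ y), (Real.norm_eq_abs _).ge.trans (φ.norm_coe_le_norm y)]
  rw [wordWeight_wordList_substring hl, ← sum_add_eq_birkhoffSum, Finset.mul_sum, Nat.cast_sum]
  refine (Finset.sum_le_sum fun i _ =>
    scaledEntry_le (hχ.abs_val_entryAt_sub_le hψ n _) (one_le _)).trans_eq ?_
  rw [Finset.sum_add_distrib, Finset.sum_const, Finset.card_range, nsmul_eq_mul]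

end WordWeight

section PressureBound

/-- A computable substitute for the logarithm of `exp (N * C) * Z_N(φ)`, multiplied by `n + 1` and
rounded up. The oracle value `c` approximates `φ`, its entries are relative to the list `L`, and the
words of length `N` are read off the middle of the words in `W`. -/
noncomputable def logPartitionBound (n C N : ℕ) (c : ℕ × List RatCode) (L W : List (List ℕ)) : ℕ :=
  ceilLogSum n (W.dedup.map (wordWeight n C N L c))

/-- The upper bound for the pressure that the oracles yield at precision `2⁻ⁿ`, with the potential
shifted by `C` and Birkhoff sums of the odd length `2 * m + 1`. -/
noncomputable def pressureBound (ψ : ℕ → List (List ℕ)) (χ : ℕ → ℕ × List RatCode) :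
    ℕ × ℕ × ℕ → RatCode := fun (n, C, m) =>
  (logPartitionBound n C (2 * m + 1) (χ n) (ψ (χ n).1) (ψ (m + (χ n).1)),
    C * ((n + 1) * (2 * m + 1)), 2 * m * (n + 1) + n)

variable {d : ℕ} {X : Subshift (Fin d) ℤ} {φ : C(X.carrier, ℝ)} {ψ : ℕ → List (List ℕ)}
  {χ : ℕ → ℕ × List RatCode} {n C N j : ℕ}

theorem log_partitionFunction_le_logPartitionBound (hX : X.carrier.Nonempty)
    (hψ : IsLanguageOracle X ψ) (hχ : IsPotentialOracle X ψ φ χ)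
    (hj : N + 2 * (χ n).1 ≤ 2 * j + 1) (C : ℕ) :
    Real.log (partitionFunction X φ N) ≤
      logPartitionBound n C N (χ n) (ψ (χ n).1) (ψ j) / ((n : ℝ) + 1) - N * C := by
  set weight := wordWeight n C N (ψ (χ n).1) (χ n)
  have sum_exp_weight_le := sum_exp_le_exp_ceilLogSum n ((ψ j).dedup.map weight)
  rw [List.map_map, hψ.sum_dedup] at sum_exp_weight_le
  rw [Real.log_le_iff_le_exp (partitionFunction_pos φ hX N), Real.exp_sub]
  refine (partitionFunction_le_sum_exp φ (a := (χ n).1) (l := 2 * j + 1) (by omega)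
    (fun w => weight (wordList w) / ((n : ℝ) + 2) - N * C) fun x => ?_).trans ?_
  · rw [le_sub_iff_add_le, le_div_iff₀' (by positivity)]
    exact hχ.le_wordWeight hψ hj C x
  · simp only [Real.exp_sub, ← Finset.sum_div]
    gcongr
    exact sum_exp_weight_le

theorem wordWeight_div_le (hψ : IsLanguageOracle X ψ) (hχ : IsPotentialOracle X ψ φ χ)
    (hC : ‖φ‖ + 1 ≤ C) (hj : N + 2 * (χ n).1 = 2 * j + 1) (x : X.carrier) :
    wordWeight n C N (ψ (χ n).1) (χ n) (wordList (substring x.1 0 (2 * j + 1))) / ((n : ℝ) + 1) ≤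
      birkhoffSum (shiftMap X) φ (2 * j + 1) x + 2 * (χ n).1 * ‖φ‖ +
        N * (C + (2 * C + 5) * ((n : ℝ) + 1)⁻¹) := by
  set k := (χ n).1
  have weight_le := hχ.wordWeight_le hψ hj.le hC ((shiftMap X)^[k] x)
  rw [substring_shiftMap_iterate, add_neg_cancel] at weight_le
  have sum_le_shifted := birkhoffSum_shiftMap_iterate_le φ k N k x
  rw [show k + N + k = 2 * j + 1 by omega] at sum_le_shifted
  have sum_le : birkhoffSum (shiftMap X) φ N ((shiftMap X)^[k] x) ≤ N * C :=
    (abs_le.1 (abs_birkhoffSum_le φ N _)).2.trans (by gcongr; linarith)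
  calc _ ≤ (((n : ℝ) + 2) * (birkhoffSum (shiftMap X) φ N ((shiftMap X)^[k] x) + N * C) + N * 5) /
        ((n : ℝ) + 1) := by gcongr
    _ = birkhoffSum (shiftMap X) φ N ((shiftMap X)^[k] x) + N * C +
        (birkhoffSum (shiftMap X) φ N ((shiftMap X)^[k] x) + N * C + N * 5) *
          ((n : ℝ) + 1)⁻¹ := by
      field_simp
      ring
    _ ≤ birkhoffSum (shiftMap X) φ (2 * j + 1) x + 2 * k * ‖φ‖ + N * C +
        (N * C + N * C + N * 5) * ((n : ℝ) + 1)⁻¹ := by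
      gcongr
      linarith
    _ = _ := by ring

theorem logPartitionBound_le (hX : X.carrier.Nonempty) (hψ : IsLanguageOracle X ψ)
    (hχ : IsPotentialOracle X ψ φ χ) (hC : ‖φ‖ + 1 ≤ C) (hj : N + 2 * (χ n).1 = 2 * j + 1) :
    (logPartitionBound n C N (χ n) (ψ (χ n).1) (ψ j) : ℝ) ≤
      (n + 2) * (Real.log (partitionFunction X φ (2 * j + 1)) + 2 * (χ n).1 * ‖φ‖ +
        N * (C + (2 * C + 5) * ((n : ℝ) + 1)⁻¹)) + 1 := by
  set weight := wordWeight n C N (ψ (χ n).1) (χ n)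
  set shift : ℝ := 2 * (χ n).1 * ‖φ‖ + N * (C + (2 * C + 5) * ((n : ℝ) + 1)⁻¹) with hshift
  have partitionFunction_pos := partitionFunction_pos φ hX (2 * j + 1)
  rw [add_assoc (Real.log _), ← hshift]
  refine ceilLogSum_le_of_sum_exp_le ?_ ?_
  · have log_ge := neg_le_log_partitionFunction φ hX (2 * j + 1)
    have norm_le : N * ‖φ‖ ≤ N * (C + (2 * C + 5) * ((n : ℝ) + 1)⁻¹) := by
      gcongr
      have : (0 : ℝ) ≤ (2 * C + 5) * ((n : ℝ) + 1)⁻¹ := by positivity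
      linarith
    rw [← hj] at log_ge ⊢
    push_cast at log_ge
    linarith
  · rw [List.map_map, hψ.sum_dedup, Real.exp_add, Real.exp_log partitionFunction_pos,
      ← div_le_iff₀ (Real.exp_pos _), Finset.sum_div]
    simp only [Function.comp_apply, ← Real.exp_sub]
    refine sum_exp_le_partitionFunction φ
      (fun w => (weight (wordList w) : ℝ) / ((n : ℝ) + 1) - shift) fun x => ?_
    linarith [wordWeight_div_le hψ hχ hC hj x]

theorem val_pressureBound (n C m : ℕ) : ((pressureBound ψ χ (n, C, m)).val : ℝ) =
    logPartitionBound n C (2 * m + 1) (χ n) (ψ (χ n).1) (ψ (m + (χ n).1)) / ((n : ℝ) + 1) /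
      ((2 * m + 1 : ℕ) : ℝ) - C := by
  simp only [pressureBound, RatCode.val]
  push_cast
  rw [show (2 * m * (n + 1) + n + 1 : ℝ) = (n + 1) * (2 * m + 1) by ring]
  field_simp

theorem pressure_le_pressureBound (hX : X.carrier.Nonempty) (hψ : IsLanguageOracle X ψ)
    (hχ : IsPotentialOracle X ψ φ χ) (a : ℕ × ℕ × ℕ) :
    pressure X φ ≤ (pressureBound ψ χ a).val := by
  obtain ⟨n, C, m⟩ := a
  have length_pos : (0 : ℝ) < (2 * m + 1 : ℕ) := by positivity
  refine (pressure_le φ hX (Nat.le_add_left 1 (2 * m))).trans ?_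
  rw [val_pressureBound, one_div_mul_eq_div, le_sub_iff_add_le, div_add' _ _ _ length_pos.ne',
    div_le_div_iff_of_pos_right length_pos, mul_comm (C : ℝ), ← le_sub_iff_add_le]
  exact log_partitionFunction_le_logPartitionBound hX hψ hχ (by omega) C

theorem val_pressureBound_le (hX : X.carrier.Nonempty) (hψ : IsLanguageOracle X ψ)
    (hχ : IsPotentialOracle X ψ φ χ) (hC : ‖φ‖ + 1 ≤ C) (n m : ℕ) :
    ((pressureBound ψ χ (n, C, m)).val : ℝ) ≤ (1 + ((n : ℝ) + 1)⁻¹) *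
      (1 / ((2 * m + 1 : ℕ) : ℝ) * Real.log (partitionFunction X φ (2 * m + 1)) +
        (Real.log (partitionFunction X φ (2 * (χ n).1)) + 2 * (χ n).1 * ‖φ‖) /
          ((2 * m + 1 : ℕ) : ℝ) + (C + (2 * C + 5) * ((n : ℝ) + 1)⁻¹)) +
        ((n : ℝ) + 1)⁻¹ / ((2 * m + 1 : ℕ) : ℝ) - C := by
  have bound_le := logPartitionBound_le (n := n) (N := 2 * m + 1) (j := m + (χ n).1) hX hψ hχ hC
    (by omega)
  have log_le := log_partitionFunction_add_le φ hX (2 * m + 1) (2 * (χ n).1)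
  rw [show 2 * m + 1 + 2 * (χ n).1 = 2 * (m + (χ n).1) + 1 by ring] at log_le
  rw [val_pressureBound]
  gcongr ?_ - _
  refine (div_le_div_of_nonneg_right (div_le_div_of_nonneg_right (bound_le.trans
    (add_le_add_left (mul_le_mul_of_nonneg_left (add_le_add_left (add_le_add_left log_le _) _)
      (by positivity)) _)) (by positivity)) (by positivity)).trans_eq ?_
  field_simp
  ring

theorem exists_pressureBound_lt (hX : X.carrier.Nonempty) (hψ : IsLanguageOracle X ψ)
    (hχ : IsPotentialOracle X ψ φ χ) {y : ℝ} (hy : pressure X φ < y) :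
    ∃ a, ((pressureBound ψ χ a).val : ℝ) < y := by
  obtain ⟨C, hC⟩ := exists_nat_ge (‖φ‖ + 1)
  have tendsto_inv : Tendsto (fun n : ℕ => ((n : ℝ) + 1)⁻¹) atTop (𝓝 0) := by
    simpa only [one_div] using tendsto_one_div_add_atTop_nhds_zero_nat (𝕜 := ℝ)
  have tendsto_precision : Tendsto (fun n : ℕ => (1 + ((n : ℝ) + 1)⁻¹) *
      (pressure X φ + (C + (2 * C + 5) * ((n : ℝ) + 1)⁻¹)) - C) atTop (𝓝 (pressure X φ)) := by
    have tendsto_error := (tendsto_inv.const_mul (2 * (C : ℝ) + 5)).const_add (C : ℝ)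
    simpa using
      ((tendsto_inv.const_add 1).mul (tendsto_error.const_add (pressure X φ))).sub_const (C : ℝ)
  obtain ⟨n, hn⟩ := (tendsto_precision.eventually_lt_const hy).exists
  have tendsto_odd : Tendsto (fun m : ℕ => 2 * m + 1) atTop atTop :=
    tendsto_atTop_mono (fun m => show m ≤ 2 * m + 1 by omega) tendsto_id
  have tendsto_div (b : ℝ) : Tendsto (fun m : ℕ => b / ((2 * m + 1 : ℕ) : ℝ)) atTop (𝓝 0) :=
    (tendsto_const_div_atTop_nhds_zero_nat b).comp tendsto_odd
  have tendsto_length := (((((tendsto_log_partitionFunction φ hX).comp tendsto_odd).add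
    (tendsto_div (Real.log (partitionFunction X φ (2 * (χ n).1)) + 2 * (χ n).1 * ‖φ‖))).add_const
      (C + (2 * C + 5) * ((n : ℝ) + 1)⁻¹)).const_mul (1 + ((n : ℝ) + 1)⁻¹)).add
        (tendsto_div ((n : ℝ) + 1)⁻¹) |>.sub_const (C : ℝ)
  rw [add_zero, add_zero] at tendsto_length
  obtain ⟨m, hm⟩ := (tendsto_length.eventually_lt_const hn).exists
  exact ⟨(n, C, m), (val_pressureBound_le hX hψ hχ hC n m).trans_lt hm⟩

theorem isGLB_pressureBound (hX : X.carrier.Nonempty) (hψ : IsLanguageOracle X ψ)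
    (hχ : IsPotentialOracle X ψ φ χ) :
    IsGLB (Set.range fun a => ((pressureBound ψ χ a).val : ℝ)) (pressure X φ) := by
  refine ⟨?_, fun b hb => le_of_forall_gt_imp_ge_of_dense fun y hy => ?_⟩
  · rintro _ ⟨a, rfl⟩
    exact pressure_le_pressureBound hX hψ hχ a
  · obtain ⟨a, ha⟩ := exists_pressureBound_lt hX hψ hχ hy
    exact (hb ⟨a, rfl⟩).trans ha.le

end PressureBound

section Computability

variable {α : Type} [Primcodable α]

theorem primrec_nat_pow : Primrec₂ fun a b : ℕ => a ^ b :=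
  Primrec₂.unpaired'.1 Nat.Primrec.pow

theorem primrec_list_sum : Primrec (List.sum : List ℕ → ℕ) :=
  Primrec.list_foldr Primrec.id (Primrec.const 0) (Primrec.nat_add.comp
    (Primrec.fst.comp Primrec.snd) (Primrec.snd.comp Primrec.snd)).to₂

theorem primrec_list_dedup [DecidableEq α] : Primrec (List.dedup : List α → List α) := by
  have mem : PrimrecPred fun p : List α × α × List α => p.2.1 ∈ p.2.2 :=
    (PrimrecRel.exists_mem_list Primrec.eq).comp (Primrec.snd.comp Primrec.snd)
      (Primrec.fst.comp Primrec.snd) |>.of_eq fun p => by simp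
  refine (Primrec.list_foldr (h := fun _ p => if p.1 ∈ p.2 then p.2 else p.1 :: p.2) Primrec.id
    (Primrec.const []) (Primrec.ite mem (Primrec.snd.comp Primrec.snd)
      (Primrec.list_cons.comp (Primrec.fst.comp Primrec.snd)
        (Primrec.snd.comp Primrec.snd))).to₂).of_eq fun l => ?_
  induction l with
  | nil => rfl
  | cons a l ih =>
    simp only [id, List.foldr_cons, List.dedup_cons] at ih ⊢
    simp [ih]

theorem computable_of_primrecPred_le {f : α → ℕ}
    (hf : PrimrecPred fun p : α × ℕ => f p.1 ≤ p.2) : Computable f :=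
  (Computable.find (P := fun a n => f a ≤ n) hf.computablePred fun a => ⟨f a, le_rfl⟩).of_eq
    fun _ => (Nat.find_eq_iff _).2 ⟨le_rfl, fun _ => not_le.2⟩

theorem computable_ceilLogSum : Computable fun a : ℕ × List ℕ => ceilLogSum a.1 a.2 := by
  have base : Primrec fun a : (ℕ × List ℕ) × ℕ => a.1.1 + 1 :=
    Primrec.succ.comp (Primrec.fst.comp Primrec.fst)
  have total : Primrec fun a : (ℕ × List ℕ) × ℕ => a.1.2.sum :=
    primrec_list_sum.comp (Primrec.snd.comp Primrec.fst)
  have summand : Primrec₂ fun (a : (ℕ × List ℕ) × ℕ) (t : ℕ) =>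
      (a.1.1 + 2) ^ t * (a.1.1 + 1) ^ (a.1.2.sum - t) :=
    Primrec.nat_mul.comp
      (primrec_nat_pow.comp ((Primrec.succ.comp base).comp Primrec.fst) Primrec.snd)
      (primrec_nat_pow.comp (base.comp Primrec.fst)
        (Primrec.nat_sub.comp (total.comp Primrec.fst) Primrec.snd))
  refine computable_of_primrecPred_le ((Primrec.nat_le.comp
    (Primrec.nat_mul.comp
      (primrec_list_sum.comp (Primrec.list_map (Primrec.snd.comp Primrec.fst) summand))
      (primrec_nat_pow.comp base Primrec.snd))
    (Primrec.nat_mul.comp (primrec_nat_pow.comp (Primrec.succ.comp base) Primrec.snd)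
      (primrec_nat_pow.comp base total))).of_eq fun a => ?_)
  exact ceilLogSum_le_iff_nat.symm

theorem scaledEntry_eq_div (n C : ℕ) (r : RatCode) : scaledEntry n C r =
    ((r.1 + C * (r.2.2 + 1) - r.2.1) * (n + 2) + r.2.2) / (r.2.2 + 1) + 2 := by
  obtain ⟨a, b, c⟩ := r
  rw [scaledEntry, Nat.add_right_cancel_iff]
  refine eq_of_forall_ge_iff fun t => ?_
  have val_add : RatCode.val (a, b, c) + C = (a + C * (c + 1) - b) / (c + 1) := by
    rw [RatCode.val]
    field_simp
    ring
  rw [Nat.ceil_le, val_add, mul_div_assoc', div_le_iff₀ (by positivity),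
    Nat.div_le_iff_le_mul_add_pred (Nat.succ_pos c), Nat.succ_sub_one, tsub_mul,
    Nat.add_le_add_iff_right, tsub_le_iff_right, mul_sub, sub_le_iff_le_add,
    ← Nat.cast_le (α := ℚ)]
  push_cast
  ring_nf

variable {n C N : α → ℕ} {L : α → List (List ℕ)} {c : α → ℕ × List RatCode}

theorem primrec_scaledEntry {r : α → RatCode} (hn : Primrec n) (hC : Primrec C)
    (hr : Primrec r) : Primrec fun a => scaledEntry (n a) (C a) (r a) := by
  simp only [scaledEntry_eq_div]
  have den : Primrec fun a => (r a).2.2 := Primrec.snd.comp (Primrec.snd.comp hr)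
  have num : Primrec fun a => (r a).1 + C a * ((r a).2.2 + 1) - (r a).2.1 :=
    Primrec.nat_sub.comp (Primrec.nat_add.comp (Primrec.fst.comp hr)
      (Primrec.nat_mul.comp hC (Primrec.succ.comp den))) (Primrec.fst.comp (Primrec.snd.comp hr))
  exact Primrec.nat_add.comp (Primrec.nat_div.comp
    (Primrec.nat_add.comp
      (Primrec.nat_mul.comp num (Primrec.nat_add.comp hn (Primrec.const 2))) den)
    (Primrec.succ.comp den)) (Primrec.const 2)

theorem primrec_entryAt {q : α → List RatCode} {v : α → List ℕ} (hL : Primrec L) (hq : Primrec q)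
    (hv : Primrec v) : Primrec fun a => entryAt (L a) (q a) (v a) :=
  (Primrec.list_getD default).comp hq (Primrec.list_findIdx hL
    (Primrec.eq.decide.comp Primrec.snd (hv.comp Primrec.fst)).to₂)

theorem primrec_wordWeight {w : α → List ℕ} (hn : Primrec n) (hC : Primrec C) (hN : Primrec N)
    (hL : Primrec L) (hc : Primrec c) (hw : Primrec w) :
    Primrec fun a => wordWeight (n a) (C a) (N a) (L a) (c a) (w a) := by
  have radius : Primrec fun a : α × ℕ => (c a.1).1 :=
    Primrec.fst.comp (hc.comp Primrec.fst)
  have window : Primrec fun a : α × ℕ => ((w a.1).drop a.2).take (2 * (c a.1).1 + 1) :=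
    Primrec.list_take.comp (Primrec.succ.comp (Primrec.nat_mul.comp (Primrec.const 2) radius))
      (Primrec.list_drop.comp Primrec.snd (hw.comp Primrec.fst))
  have entry : Primrec fun a : α × ℕ => scaledEntry (n a.1) (C a.1)
      (entryAt (L a.1) (c a.1).2 (((w a.1).drop a.2).take (2 * (c a.1).1 + 1))) :=
    primrec_scaledEntry (hn.comp Primrec.fst) (hC.comp Primrec.fst)
      (primrec_entryAt (hL.comp Primrec.fst) (Primrec.snd.comp (hc.comp Primrec.fst)) window)
  exact primrec_list_sum.comp (Primrec.list_map (Primrec.list_range.comp hN) entry.to₂)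

theorem computable_logPartitionBound {W : α → List (List ℕ)} (hn : Primrec n) (hC : Primrec C)
    (hN : Primrec N) (hc : Primrec c) (hL : Primrec L) (hW : Primrec W) :
    Computable fun a => logPartitionBound (n a) (C a) (N a) (c a) (L a) (W a) := by
  have weight : Primrec₂ fun a w => wordWeight (n a) (C a) (N a) (L a) (c a) w :=
    primrec_wordWeight (hn.comp Primrec.fst) (hC.comp Primrec.fst) (hN.comp Primrec.fst)
      (hL.comp Primrec.fst) (hc.comp Primrec.fst) Primrec.snd
  have arguments : Primrec fun a =>
      (n a, (W a).dedup.map (wordWeight (n a) (C a) (N a) (L a) (c a))) :=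
    hn.pair (Primrec.list_map (primrec_list_dedup.comp hW) weight)
  simpa only [logPartitionBound] using computable_ceilLogSum.comp arguments.to_comp

theorem oracleComputable_pressureBound :
    OracleComputable (fun ω : (ℕ → List (List ℕ)) × (ℕ → ℕ × List RatCode) => oracles ω.1 ω.2)
      fun ω => pressureBound ω.1 ω.2 := by
  set O := fun ω : (ℕ → List (List ℕ)) × (ℕ → ℕ × List RatCode) => oracles ω.1 ω.2
  have language : OracleComputable O fun ω => ω.1 := .query (i := 0) fun _ _ => rfl
  have potential : OracleComputable O fun ω (a : ℕ × ℕ × ℕ) => ω.2 a.1 :=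
    (OracleComputable.query (i := 1) fun _ _ => rfl).comp (.of_computable Computable.fst)
  have windows : OracleComputable O fun ω (a : ℕ × ℕ × ℕ) => ω.1 (ω.2 a.1).1 :=
    language.comp ((OracleComputable.of_computable Computable.fst).comp potential)
  have radius_add : OracleComputable O fun ω (a : ℕ × ℕ × ℕ) => a.2.2 + (ω.2 a.1).1 := by
    have add : Primrec fun b : (ℕ × ℕ × ℕ) × ℕ × List RatCode => b.1.2.2 + b.2.1 :=
      Primrec.nat_add.comp (Primrec.snd.comp (Primrec.snd.comp Primrec.fst))
        (Primrec.fst.comp Primrec.snd)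
    exact (OracleComputable.of_computable add.to_comp).comp
      ((OracleComputable.of_computable Computable.id).pair potential)
  have arguments : OracleComputable O fun ω (a : ℕ × ℕ × ℕ) =>
      (a, ω.2 a.1, ω.1 (ω.2 a.1).1, ω.1 (a.2.2 + (ω.2 a.1).1)) :=
    (OracleComputable.of_computable Computable.id).pair
      (potential.pair (windows.pair (language.comp radius_add)))
  have odd_length : Primrec fun a : ℕ × ℕ × ℕ => 2 * a.2.2 + 1 :=
    Primrec.succ.comp (Primrec.nat_mul.comp (Primrec.const 2) (Primrec.snd.comp Primrec.snd))
  have numerator : Computable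
      fun b : (ℕ × ℕ × ℕ) × (ℕ × List RatCode) × List (List ℕ) × List (List ℕ) =>
        logPartitionBound b.1.1 b.1.2.1 (2 * b.1.2.2 + 1) b.2.1 b.2.2.1 b.2.2.2 :=
    computable_logPartitionBound (Primrec.fst.comp Primrec.fst)
      (Primrec.fst.comp (Primrec.snd.comp Primrec.fst)) (odd_length.comp Primrec.fst)
      (Primrec.fst.comp Primrec.snd) (Primrec.fst.comp (Primrec.snd.comp Primrec.snd))
      (Primrec.snd.comp (Primrec.snd.comp Primrec.snd))
  have shift : Primrec fun a : ℕ × ℕ × ℕ => a.2.1 * ((a.1 + 1) * (2 * a.2.2 + 1)) :=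
    Primrec.nat_mul.comp (Primrec.fst.comp Primrec.snd)
      (Primrec.nat_mul.comp (Primrec.succ.comp Primrec.fst) odd_length)
  have denominator : Primrec fun a : ℕ × ℕ × ℕ => 2 * a.2.2 * (a.1 + 1) + a.1 :=
    Primrec.nat_add.comp (Primrec.nat_mul.comp
      (Primrec.nat_mul.comp (Primrec.const 2) (Primrec.snd.comp Primrec.snd))
      (Primrec.succ.comp Primrec.fst)) Primrec.fst
  exact ((OracleComputable.of_computable numerator).comp arguments).pair
    (.of_computable (shift.pair denominator).to_comp)

end Computability

end SubshiftPressure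

theorem mainTheorem8 :
    (∃ M : SubshiftPressure.OracleCode (Fin 2),
      ∀ (d : ℕ) (X : Subshift (Fin d) ℤ), X.carrier.Nonempty →
        ∀ ψ : ℕ → List (List ℕ), SubshiftPressure.IsLanguageOracle X ψ →
          SubshiftPressure.UpperSemicomputes M X ψ (SubshiftPressure.pressure X)) ∧
    (∀ (d : ℕ) (X : Subshift (Fin d) ℤ), X.carrier.Nonempty → ∀ φ : C(X.carrier, ℝ),
      Tendsto
        (fun n : ℕ => 1 / (n : ℝ) * Real.log (SubshiftPressure.partitionFunction X φ n))
        atTop (𝓝 (SubshiftPressure.pressure X φ)) ∧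
      IsGLB {r : ℝ | ∃ n : ℕ, 1 ≤ n ∧
          r = 1 / (n : ℝ) * Real.log (SubshiftPressure.partitionFunction X φ n)}
        (SubshiftPressure.pressure X φ)) := by
  refine ⟨?_, fun d X hX φ => ⟨SubshiftPressure.tendsto_log_partitionFunction φ hX,
    SubshiftPressure.isGLB_pressure φ hX⟩⟩
  obtain ⟨M, hM⟩ := SubshiftPressure.oracleComputable_pressureBound.exists_approximatesFromAbove
  exact ⟨M, fun d X hX ψ hψ φ χ hχ => hM (ψ, χ) _ (SubshiftPressure.isGLB_pressureBound hX hψ hχ)⟩
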